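/- A $(\vee,0)$-semilattice $S$ is \emph{distributive} if for all $a,b,c\in S$ with $c\le a\vee b$ there are $a'\le a$ and $b'\le b$ in $S$ such that $c=a'\vee b'$. Let $\mathcal{F}$ be the class of all groups isomorphic to a finite (possibly empty) direct product of alternating groups $\mathfrak{A}_n$ with $n\ge 5$. (1) For every distributive $(\vee,0)$-semilattice $S$ of cardinality at most $\aleph_1$, there is a group $G$ which is a direct limit (over a nonempty directed partially ordered set, with arbitrary group homomorphisms as transition maps) of members of $\mathcal{F}$, such that $S$ is isomorphic to the $(\vee,0)$-semilattice, under inclusion, of all those normal subgroups of $G$ that are finitely generated as normal subgroups (that is, are the normal closure of a finite subset of $G$). (2) For every distributive algebraic lattice $L$ (that is, a distributive complete lattice in which every element is a join of compact elements) with at most $\aleph_1$ compact elements, there is a locally finite group $G$ (that is, a group all of whose finitely generated subgroups are finite) such that $L$ is isomorphic to the lattice of all normal subgroups of $G$, ordered by inclusion. -/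

import Mathlib

open scoped Cardinal

universe u

/-- A `(∨,0)`-semilattice `S` is distributive if whenever `c ≤ a ∨ b`, there are `a' ≤ a` and
`b' ≤ b` with `c = a' ∨ b'`. -/
def IsDistribSemilattice (S : Type u) [SemilatticeSup S] [OrderBot S] : Prop :=
  ∀ a b c : S, c ≤ a ⊔ b → ∃ a' b' : S, a' ≤ a ∧ b' ≤ b ∧ c = a' ⊔ b'

/-- `G` is a finite (possibly empty) product of alternating groups of degrees at least `5`. -/
def IsFinProdAlternating (G : Type u) [Group G] : Prop :=
  ∃ (k : ℕ) (n : Fin k → ℕ), (∀ i, 5 ≤ n i) ∧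
    Nonempty (G ≃* ((i : Fin k) → alternatingGroup (Fin (n i))))

/-- `G` is the direct limit of a direct system, indexed by a nonempty directed partially ordered
set, of finite products of alternating groups of degrees at least `5` and arbitrary group
homomorphisms. -/
def IsDirectLimitOfFinProdAlternating (G : Type u) [Group G] : Prop :=
  ∃ (ι : Type u) (_ : PartialOrder ι) (_ : IsDirectedOrder ι) (_ : Nonempty ι)
    (A : ι → Type u) (_ : ∀ i, Group (A i)) (f : ∀ i j : ι, i ≤ j → A i →* A j)
    (_ : DirectedSystem A (fun i j h => f i j h)),
    (∀ i, IsFinProdAlternating (A i)) ∧ Nonempty (G ≃* DirectLimit A f)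

/-- The normal subgroups of `G` that are finitely generated as normal subgroups (normal closures
of finite sets), ordered by inclusion. -/
abbrev FGNormalSubgroup (G : Type u) [Group G] : Type u :=
  {N : Subgroup G // ∃ s : Set G, s.Finite ∧ Subgroup.normalClosure s = N}

theorem normalClosure_union_eq {G : Type u} [Group G] (s t : Set G) :
    Subgroup.normalClosure (s ∪ t) = Subgroup.normalClosure s ⊔ Subgroup.normalClosure t := by
  apply le_antisymm
  · apply Subgroup.normalClosure_le_normal
    rintro x (hx | hx)
    · exact (le_sup_left : Subgroup.normalClosure s ≤ _) (Subgroup.subset_normalClosure hx)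
    · exact (le_sup_right : Subgroup.normalClosure t ≤ _) (Subgroup.subset_normalClosure hx)
  · exact sup_le (Subgroup.normalClosure_mono Set.subset_union_left)
      (Subgroup.normalClosure_mono Set.subset_union_right)

/-- The join of two finitely generated normal subgroups is their join as subgroups. -/
instance FGNormalSubgroup.instSemilatticeSup (G : Type u) [Group G] :
    SemilatticeSup (FGNormalSubgroup G) :=
  Subtype.semilatticeSup (by
    rintro M N ⟨s, hs, rfl⟩ ⟨t, ht, rfl⟩
    exact ⟨s ∪ t, hs.union ht, normalClosure_union_eq s t⟩)

/-- The zero element is the trivial subgroup. -/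
instance FGNormalSubgroup.instOrderBot (G : Type u) [Group G] :
    OrderBot (FGNormalSubgroup G) :=
  Subtype.orderBot ⟨∅, Set.finite_empty,
    le_bot_iff.mp (Subgroup.normalClosure_le_normal (Set.empty_subset _))⟩

/-- The lattice of all normal subgroups of `G`, ordered by inclusion. -/
abbrev NormalSubgroupLattice (G : Type u) [Group G] : Type u :=
  {N : Subgroup G // N.Normal}

/-- A group is locally finite if all its finitely generated subgroups are finite. -/
def IsLocallyFiniteGroup (G : Type u) [Group G] : Prop :=
  ∀ H : Subgroup G, H.FG → Finite H

/-! ### Finite join relations in a distributive semilattice are induced from Boolean ones. -/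

section Flatness

variable {S : Type u} [SemilatticeSup S] [OrderBot S]

/-! Both parts follow from a group `G` with a surjective conjugation-invariant norm `ν : G → S` that
vanishes only at `1` and satisfies `x ∈ normalClosure Y ↔ ν x ≤ ⋁ ν(Y)` for finite `Y`. The norm
then identifies `S` with the finitely generated normal subgroups. When `S` consists of the compact
elements of `L`, it identifies `L` with all normal subgroups. If moreover every finite subset of `G`
lies in a subgroup that is a product of alternating groups, then `G` is both locally finite and a
direct limit of such subgroups.

The core is amalgamation of two finite normed groups over a common part (`exists_amalgam`).
Distributivity lifts the finitely many norm values to subsets of a finite set `J`, keeping all join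
relations (`exists_boolean_lift`). For each `j` the elements whose subset omits `j` form a normal
subgroup. The two quotients embed compatibly into one alternating group (`exists_perm_amalgam`). In
the product over `J` the norm is read off the support, and supports control normal closures because
the factors are simple with trivial centre.

Amalgamating repeatedly along an exhaustion by finite subgroups extends a countable locally finite
normed group by a countable one that witnesses all its norm inequalities and attains one more value
(`exists_extension`). Iterating this `ω₁` times, with unions of countable chains, gives `G`. Every
stage must stay countable, so two-sided amalgams suffice exactly up to `ℵ₁` values. -/

theorem IsDistribSemilattice.exists_eq_sup (hS : IsDistribSemilattice S) {J : Type*}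
    (Z : Finset J) (s : J → S) {a : S} (ha : a ≤ Z.sup s) :
    ∃ t : J → S, (∀ k ∈ Z, t k ≤ s k) ∧ a = Z.sup t := by
  classical
  induction Z using Finset.induction_on generalizing a with
  | empty => exact ⟨s, by simp, by simpa using ha⟩
  | insert k Z hk ih =>
    rw [Finset.sup_insert] at ha
    obtain ⟨b, c, hb, hc, rfl⟩ := hS _ _ _ ha
    obtain ⟨t, ht, rfl⟩ := ih hc
    refine ⟨Function.update t k b, ?_, ?_⟩
    · intro j hj
      rcases Finset.mem_insert.1 hj with rfl | hjZ
      · simpa using hb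
      · rw [Function.update_of_ne (by rintro rfl; exact hk hjZ)]
        exact ht j hjZ
    · rw [Finset.sup_insert, Function.update_self]
      congr 1
      exact Finset.sup_congr rfl fun j hj => by
        rw [Function.update_of_ne (by rintro rfl; exact hk hj)]

/-- One relation between suprema in a distributive semilattice can be realized by splitting the
generators. -/
theorem IsDistribSemilattice.exists_splitting (hS : IsDistribSemilattice S) {J : Type u}
    [Fintype J] [DecidableEq J] (s : J → S) (W Z : Finset J) (hWZ : W.sup s ≤ Z.sup s) :
    ∃ (K : Type u) (_ : Fintype K) (_ : DecidableEq K) (p : J → Finset K) (t : K → S),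
      (∀ j, s j = (p j).sup t) ∧ W.biUnion p ⊆ Z.biUnion p := by
  have key : ∀ j, ∃ t : J → S, j ∈ W → (∀ k ∈ Z, t k ≤ s k) ∧ s j = Z.sup t := by
    intro j
    by_cases hj : j ∈ W
    · obtain ⟨t, ht⟩ := hS.exists_eq_sup Z s ((Finset.le_sup hj).trans hWZ)
      exact ⟨t, fun _ => ht⟩
    · exact ⟨s, fun h => absurd h hj⟩
  choose t ht using key
  -- `inr (i, k)` stands for the part `t i k` of `s i` below `s k`. An index of `W \ Z` is replaced
  -- by its parts; an index `k ∈ Z` keeps itself and absorbs the parts `t i k ≤ s k`, which leaves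
  -- its join unchanged.
  refine ⟨J ⊕ J × J, inferInstance, inferInstance,
    fun j => if j ∈ Z then insert (Sum.inl j) ((W \ Z).image fun i => Sum.inr (i, j))
      else if j ∈ W then Z.image fun k => Sum.inr (j, k) else {Sum.inl j},
    Sum.elim s fun q => t q.1 q.2, ?_, ?_⟩
  · intro j
    by_cases hZ : j ∈ Z
    · simp only [hZ, if_true, Finset.sup_insert, Sum.elim_inl, Finset.sup_image]
      refine (sup_eq_left.2 (Finset.sup_le fun i hi => ?_)).symm
      exact (ht i (Finset.mem_sdiff.1 hi).1).1 j hZ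
    · by_cases hW : j ∈ W
      · simp only [hZ, hW, if_true, if_false, Finset.sup_image]
        exact (ht j hW).2
      · simp [hZ, hW]
  · intro q hq
    obtain ⟨j, hjW, hq⟩ := Finset.mem_biUnion.1 hq
    by_cases hZ : j ∈ Z
    · exact Finset.mem_biUnion.2 ⟨j, hZ, hq⟩
    · simp only [hZ, hjW, if_true, if_false, Finset.mem_image] at hq
      obtain ⟨k, hk, rfl⟩ := hq
      refine Finset.mem_biUnion.2 ⟨k, hk, ?_⟩
      simp [hk, hjW, hZ]

/-- Relations are treated one at a time. Splitting the generators for a new one preserves those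
already realized, since inclusions of index sets survive `biUnion p`. -/
theorem IsDistribSemilattice.exists_realization (hS : IsDistribSemilattice S) {X : Type u}
    [Fintype X] [DecidableEq X] (ν : X → S) (R : Finset (X × Finset X))
    (hR : ∀ r ∈ R, ν r.1 ≤ r.2.sup ν) :
    ∃ (J : Type u) (_ : Fintype J) (_ : DecidableEq J) (θ : X → Finset J) (s : J → S),
      (∀ x, ν x = (θ x).sup s) ∧ ∀ r ∈ R, θ r.1 ⊆ r.2.biUnion θ := by
  induction R using Finset.induction_on with
  | empty => exact ⟨X, inferInstance, inferInstance, fun x => {x}, ν, by simp, by simp⟩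
  | insert r R _ ih =>
    obtain ⟨J, _, _, θ, s, hν, hθ⟩ := ih fun q hq => hR q (Finset.mem_insert_of_mem hq)
    have hr := hR r (Finset.mem_insert_self _ _)
    obtain ⟨K, _, _, p, t, hs, hp⟩ := hS.exists_splitting s (θ r.1) (r.2.biUnion θ) (by
      rw [← hν, Finset.sup_biUnion]
      exact hr.trans (Finset.sup_le fun x hx =>
        (hν x).le.trans (Finset.le_sup (f := fun x => (θ x).sup s) hx)))
    refine ⟨K, inferInstance, inferInstance, fun x => (θ x).biUnion p, t, ?_, ?_⟩
    · intro x
      rw [hν, Finset.sup_biUnion]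
      exact Finset.sup_congr rfl fun j _ => hs j
    · intro q hq
      have : (q.2.biUnion fun x => (θ x).biUnion p) = (q.2.biUnion θ).biUnion p := by
        rw [Finset.biUnion_biUnion]
      rw [this]
      rcases Finset.mem_insert.1 hq with rfl | hq
      · exact hp
      · exact Finset.biUnion_subset_biUnion_of_subset_left _ (hθ q hq)

/-- Every finite family in a distributive semilattice is the image of a family in a finite Boolean
semilattice that satisfies the same join relations. -/
theorem IsDistribSemilattice.exists_boolean_lift (hS : IsDistribSemilattice S) {X : Type u}
    [Finite X] (ν : X → S) :
    ∃ (J : Type u) (_ : Fintype J) (θ : X → Finset J) (s : J → S),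
      (∀ j, s j ≠ ⊥) ∧ (∀ x, ν x = (θ x).sup s) ∧
      ∀ (x : X) (Y : Finset X), ν x ≤ Y.sup ν → ∀ j ∈ θ x, ∃ y ∈ Y, j ∈ θ y := by
  classical
  have := Fintype.ofFinite X
  obtain ⟨J, _, _, θ, s, hν, hθ⟩ := hS.exists_realization ν
    (Finset.univ.filter fun r : X × Finset X => ν r.1 ≤ r.2.sup ν) (by simp)
  -- Discarding generators equal to `⊥` changes no join, and it later ensures that the support norm
  -- vanishes only at `1`.
  refine ⟨{j : J // s j ≠ ⊥}, inferInstance, fun x => (θ x).subtype _, fun j => s j,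
    fun j => j.2, ?_, ?_⟩
  · intro x
    rw [hν]
    apply le_antisymm
    · refine Finset.sup_le fun j hj => ?_
      by_cases h : s j = ⊥
      · simp [h]
      · exact Finset.le_sup (f := fun j : {j : J // s j ≠ ⊥} => s j) (b := ⟨j, h⟩) (by simpa using hj)
    · exact Finset.sup_le fun j hj => Finset.le_sup (by simpa using hj)
  · intro x Y h j hj
    have := hθ (x, Y) (by simpa using h) (by simpa using hj)
    simpa using this

end Flatness

/-! ### Amalgamating finite groups inside alternating groups. -/

section Permutations

open Equiv

theorem exists_perm_embedding_alternatingGroup (X : Type*) [Finite X] :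
    ∃ n : ℕ, 5 ≤ n ∧ ∃ h : Perm X →* alternatingGroup (Fin n), Function.Injective h := by
  classical
  have := Fintype.ofFinite X
  -- Acting on two copies of `X` squares the sign, so the permutation is even; the five fixed points
  -- bring the degree to at least `5`.
  let Y := (X ⊕ X) ⊕ Fin 5
  let d : Perm X →* Perm Y :=
    (Perm.sumCongrHom (X ⊕ X) (Fin 5)).comp
      (((Perm.sumCongrHom X X).comp ((MonoidHom.id _).prod (MonoidHom.id _))).prod 1)
  have hd : ∀ σ, d σ ∈ alternatingGroup Y := by
    intro σ
    rw [Perm.mem_alternatingGroup]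
    change Perm.sign (Perm.sumCongr (Perm.sumCongr σ σ) 1) = 1
    rw [Perm.sign_sumCongr, Perm.sign_sumCongr]
    simp
  have hinj : Function.Injective d := by
    intro σ τ h
    have h1 := Perm.sumCongrHom_injective h
    exact (Prod.mk.inj (Perm.sumCongrHom_injective (Prod.mk.inj h1).1)).1
  refine ⟨Fintype.card Y, by simp [Y],
    (Equiv.altCongrHom (Fintype.equivFin Y)).toMonoidHom.comp (d.codRestrict _ hd), ?_⟩
  intro σ τ h
  apply hinj
  have h1 := (Equiv.altCongrHom (Fintype.equivFin Y)).injective h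
  exact congrArg Subtype.val h1

/-- The action of `B` on `B × T` by right translations of the first factor. -/
def rightTranslation (B T : Type*) [Group B] : B →* Perm (B × T) where
  toFun b :=
    { toFun := fun p => (p.1 * b⁻¹, p.2)
      invFun := fun p => (p.1 * b, p.2)
      left_inv := fun p => by simp
      right_inv := fun p => by simp }
  map_one' := by ext <;> simp
  map_mul' a b := by ext <;> simp [mul_assoc]

theorem rightTranslation_injective (B T : Type*) [Group B] [Nonempty T] :
    Function.Injective (rightTranslation B T) := by
  intro a b h
  have := congrArg Prod.fst (Equiv.congr_fun h (1, Classical.arbitrary T))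
  simpa [rightTranslation] using this

/-- Coset representatives split `B` as cosets times `f.range ≅ A ⧸ f.ker`, and right translation by
`f a` moves only the second factor. Keeping `K` separate from `f.ker` lets two homomorphisms with
equal kernels share the type `A ⧸ K`. -/
theorem exists_equiv_cosets_prod {A B : Type*} [Group A] [Group B] (f : A →* B) (K : Subgroup A)
    [K.Normal] (hK : f.ker = K) :
    ∃ e : B ≃ (B ⧸ f.range) × (A ⧸ K), ∀ b a, e (b * (f a)⁻¹) =
      ((e b).1, (e b).2 * (a : A ⧸ K)⁻¹) := by
  subst hK
  let q : A ⧸ f.ker ≃* f.range := QuotientGroup.quotientKerEquivRange f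
  have hq : ∀ a : A, ((q (a : A ⧸ f.ker) : f.range) : B) = f a := fun a => rfl
  have hmem : ∀ b : B, ((b : B ⧸ f.range).out)⁻¹ * b ∈ f.range := fun b => by
    rw [← QuotientGroup.eq, QuotientGroup.out_eq']
  refine ⟨{ toFun := fun b => (b, q.symm ⟨_, hmem b⟩)
            invFun := fun p => p.1.out * (q p.2 : B)
            left_inv := fun b => by simp
            right_inv := ?_ }, ?_⟩
  · rintro ⟨t, c⟩
    have h1 : ((t.out * (q c : B) : B) : B ⧸ f.range) = t := by
      conv_rhs => rw [← QuotientGroup.out_eq' t]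
      rw [QuotientGroup.eq]
      simp
    refine Prod.ext h1 ?_
    rw [MulEquiv.symm_apply_eq]
    ext
    simp [h1]
  · intro b a
    have h1 : ((b * (f a)⁻¹ : B) : B ⧸ f.range) = b := by
      rw [QuotientGroup.eq]
      simp
    refine Prod.ext h1 ?_
    change q.symm _ = q.symm _ * _
    rw [MulEquiv.symm_apply_eq, map_mul, MulEquiv.apply_symm_apply, map_inv]
    ext
    simp [h1, hq, mul_assoc]

/-- Finite amalgams of two finite groups embed into finite permutation groups. -/
theorem exists_perm_amalgam {A B₀ B₁ : Type*} [Group A] [Group B₀] [Group B₁] [Finite B₀]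
    [Finite B₁] (f₀ : A →* B₀) (f₁ : A →* B₁) (h : f₀.ker = f₁.ker) :
    ∃ n : ℕ, 5 ≤ n ∧ ∃ (g₀ : B₀ →* alternatingGroup (Fin n)) (g₁ : B₁ →* alternatingGroup (Fin n)),
      Function.Injective g₀ ∧ Function.Injective g₁ ∧ ∀ a, g₀ (f₀ a) = g₁ (f₁ a) := by
  obtain ⟨e₀, he₀⟩ := exists_equiv_cosets_prod f₀ f₁.ker h
  obtain ⟨e₁, he₁⟩ := exists_equiv_cosets_prod f₁ f₁.ker rfl
  -- `B₀ × T₁` and `B₁ × T₀` are both identified with `T₀ × Q × T₁`. In either picture `a` acts only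
  -- on `Q`, by the same translation, so the two actions of `A` coincide.
  let T₀ := B₀ ⧸ f₀.range
  let T₁ := B₁ ⧸ f₁.range
  let Q := A ⧸ f₁.ker
  let X := (T₀ × Q) × T₁
  let c₀ : B₀ × T₁ ≃ X := e₀.prodCongr (Equiv.refl _)
  let c₁ : B₁ × T₀ ≃ X := (e₁.prodCongr (Equiv.refl _)).trans
    { toFun := fun p => ((p.2, p.1.2), p.1.1)
      invFun := fun p => ((p.2, p.1.2), p.1.1)
      left_inv := fun _ => rfl
      right_inv := fun _ => rfl }
  have : Finite X := Finite.of_equiv _ c₀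
  obtain ⟨n, hn, k, hk⟩ := exists_perm_embedding_alternatingGroup X
  refine ⟨n, hn, k.comp (c₀.permCongrHom.toMonoidHom.comp (rightTranslation B₀ T₁)),
    k.comp (c₁.permCongrHom.toMonoidHom.comp (rightTranslation B₁ T₀)),
    hk.comp (c₀.permCongrHom.injective.comp (rightTranslation_injective _ _)),
    hk.comp (c₁.permCongrHom.injective.comp (rightTranslation_injective _ _)), fun a => ?_⟩
  change k _ = k _
  congr 1
  ext1 p
  obtain ⟨⟨b₀, t₁⟩, rfl⟩ := c₀.surjective p
  obtain ⟨⟨b₁, t₀⟩, hb⟩ := c₁.surjective (c₀ (b₀, t₁))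
  have h0 : (c₀.permCongrHom (rightTranslation B₀ T₁ (f₀ a))) (c₀ (b₀, t₁)) =
      c₀ (b₀ * (f₀ a)⁻¹, t₁) := by
    simp [Equiv.permCongrHom, rightTranslation]
  have h1 : (c₁.permCongrHom (rightTranslation B₁ T₀ (f₁ a))) (c₁ (b₁, t₀)) =
      c₁ (b₁ * (f₁ a)⁻¹, t₀) := by
    simp [Equiv.permCongrHom, rightTranslation]
  change (c₀.permCongrHom (rightTranslation B₀ T₁ (f₀ a))) (c₀ (b₀, t₁)) =
    (c₁.permCongrHom (rightTranslation B₁ T₀ (f₁ a))) (c₀ (b₀, t₁))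
  rw [h0, ← hb, h1]
  change ((t₀, (e₁ b₁).2), (e₁ b₁).1) = (e₀ b₀, t₁) at hb
  change (e₀ (b₀ * (f₀ a)⁻¹), t₁) = ((t₀, (e₁ (b₁ * (f₁ a)⁻¹)).2), (e₁ (b₁ * (f₁ a)⁻¹)).1)
  rw [he₀, he₁]
  simp only [Prod.ext_iff] at hb ⊢
  simp_all

end Permutations

/-! ### Norms with values in a semilattice, and amalgamation of normed finite groups. -/

/-- A conjugation-invariant function on a group with values in a `(∨,0)`-semilattice that is
subadditive and vanishes only at the identity. -/
structure IsNormalNorm {G S : Type*} [Group G] [SemilatticeSup S] [OrderBot S] (ν : G → S) :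
    Prop where
  eq_bot_iff : ∀ x, ν x = ⊥ ↔ x = 1
  mul_le : ∀ x y, ν (x * y) ≤ ν x ⊔ ν y
  inv : ∀ x, ν x⁻¹ = ν x
  conj : ∀ x y, ν (y * x * y⁻¹) = ν x

section Norm

variable {S : Type u} [SemilatticeSup S] [OrderBot S]

namespace IsNormalNorm

variable {G H : Type*} [Group G] [Group H] {ν : G → S} {μ : H → S}

theorem one (hν : IsNormalNorm ν) : ν 1 = ⊥ := (hν.eq_bot_iff 1).2 rfl

/-- The normal subgroup of all elements with norm in an ideal, here given by a predicate. -/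
def idealSubgroup (hν : IsNormalNorm ν) (I : S → Prop) (h0 : I ⊥)
    (hI : ∀ a b c, a ≤ b ⊔ c → I b → I c → I a) : Subgroup G where
  carrier := {x | I (ν x)}
  one_mem' := by simpa [hν.one] using h0
  mul_mem' := fun {x y} hx hy => hI _ _ _ (hν.mul_le x y) hx hy
  inv_mem' := fun {x} hx => by simpa [hν.inv] using hx

theorem idealSubgroup_normal (hν : IsNormalNorm ν) (I : S → Prop) (h0 : I ⊥)
    (hI : ∀ a b c, a ≤ b ⊔ c → I b → I c → I a) : (hν.idealSubgroup I h0 hI).Normal :=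
  ⟨fun x hx y => by
    change I _
    rw [hν.conj]
    exact hx⟩

theorem injective_of_comp (hν : IsNormalNorm ν) (hμ : IsNormalNorm μ) (f : G →* H)
    (hf : ∀ x, μ (f x) = ν x) : Function.Injective f :=
  (injective_iff_map_eq_one f).2 fun x hx => by
    rw [← hν.eq_bot_iff, ← hf, hx, hμ.one]

theorem comp (hμ : IsNormalNorm μ) (f : G →* H) (hf : Function.Injective f) :
    IsNormalNorm fun x => μ (f x) where
  eq_bot_iff x := by rw [hμ.eq_bot_iff, map_eq_one_iff f hf]
  mul_le x y := by rw [map_mul]; exact hμ.mul_le _ _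
  inv x := by rw [map_inv, hμ.inv]
  conj x y := by rw [map_mul, map_mul, map_inv, hμ.conj]

end IsNormalNorm

theorem isNormalNorm_pi {J : Type*} [Fintype J] {H : J → Type*} [∀ j, Group (H j)]
    [∀ j, DecidableEq (H j)] (s : J → S) (hs : ∀ j, s j ≠ ⊥) :
    IsNormalNorm fun c : (j : J) → H j => (Finset.univ.filter fun j => c j ≠ 1).sup s where
  eq_bot_iff c := by
    rw [Finset.sup_eq_bot_iff]
    constructor
    · intro h
      funext j
      by_contra hj
      exact hs j (h j (by simpa using hj))
    · rintro rfl
      simp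
  mul_le c d := by
    classical
    rw [← Finset.sup_union]
    refine Finset.sup_mono fun j hj => ?_
    by_contra h
    simp only [Finset.mem_union, Finset.mem_filter, Finset.mem_univ, true_and, not_or,
      not_not] at h
    simp [h.1, h.2] at hj
  inv c := by simp
  conj c d := by simp [mul_inv_eq_one]

/-- The commutator of `y` with an element of the `j`-th factor stays in that factor. If the normal
closure met the factor trivially, `y j` would be central, hence `1`; by simplicity it contains the
whole factor. -/
theorem mem_normalClosure_pi {J : Type*} [Finite J] {H : J → Type*} [∀ j, Group (H j)]
    [∀ j, IsSimpleGroup (H j)] (hc : ∀ j, Subgroup.center (H j) = ⊥) (Y : Set ((j : J) → H j))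
    (c : (j : J) → H j) (h : ∀ j, c j ≠ 1 → ∃ y ∈ Y, y j ≠ 1) : c ∈ Subgroup.normalClosure Y := by
  classical
  refine Subgroup.pi_mem_of_mulSingle_mem _ fun j => ?_
  by_cases hj : c j = 1
  · rw [hj, Pi.mulSingle_one]
    exact one_mem _
  obtain ⟨y, hy, hyj⟩ := h j hj
  let M := (Subgroup.normalClosure Y).comap (MonoidHom.mulSingle H j)
  have hM : M.Normal := Subgroup.Normal.comap Subgroup.normalClosure_normal _
  suffices M = ⊤ by
    have : c j ∈ M := this ▸ Subgroup.mem_top _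
    exact this
  refine hM.eq_bot_or_eq_top.resolve_left fun hbot => hyj ?_
  rw [← Subgroup.mem_bot, ← hc j, Subgroup.mem_center_iff]
  intro u
  have hyM : y ∈ Subgroup.normalClosure Y := Subgroup.subset_normalClosure hy
  have hcomm : Pi.mulSingle j (u * y j * u⁻¹ * (y j)⁻¹) ∈ Subgroup.normalClosure Y := by
    have : Pi.mulSingle j (u * y j * u⁻¹ * (y j)⁻¹) =
        Pi.mulSingle j u * y * (Pi.mulSingle j u)⁻¹ * y⁻¹ := by
      funext i
      by_cases hi : i = j
      · subst hi; simp
      · simp [Pi.mulSingle_eq_of_ne hi]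
    rw [this]
    exact mul_mem (Subgroup.normalClosure_normal.conj_mem _ hyM _) (inv_mem hyM)
  have h1 : u * y j * u⁻¹ * (y j)⁻¹ ∈ M := hcomm
  rw [hbot, Subgroup.mem_bot] at h1
  rwa [mul_inv_eq_one, mul_inv_eq_iff_eq_mul] at h1

theorem IsFinProdAlternating.of_mulEquiv {G H : Type u} [Group G] [Group H]
    (h : IsFinProdAlternating G) (e : H ≃* G) : IsFinProdAlternating H := by
  obtain ⟨k, n, hn, ⟨e'⟩⟩ := h
  exact ⟨k, n, hn, ⟨e.trans e'⟩⟩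

theorem IsFinProdAlternating.finite {G : Type u} [Group G] (h : IsFinProdAlternating G) :
    Finite G := by
  obtain ⟨k, n, -, ⟨e⟩⟩ := h
  exact Finite.of_equiv _ e.symm.toEquiv

theorem isFinProdAlternating_pi {J : Type u} [Finite J] (n : J → ℕ) (hn : ∀ j, 5 ≤ n j) :
    IsFinProdAlternating ((j : J) → alternatingGroup (Fin (n j))) := by
  obtain ⟨k, ⟨e⟩⟩ := Finite.exists_equiv_fin J
  refine ⟨k, fun i => n (e.symm i), fun i => hn _, ⟨?_⟩⟩
  exact
    { toEquiv := Equiv.piCongrLeft' (fun j => alternatingGroup (Fin (n j))) e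
      map_mul' := fun x y => by ext; simp [Equiv.piCongrLeft'] }

/-- Finite normed groups with a common normed subgroup amalgamate into a normed finite product of
alternating groups, in which every inequality between the norms on the second group is witnessed
by normal closures. -/
theorem IsDistribSemilattice.exists_amalgam (hS : IsDistribSemilattice S) {A B₀ B₁ : Type u}
    [Group A] [Group B₀] [Group B₁] [Finite B₀] [Finite B₁] {ν₀ : B₀ → S} {ν₁ : B₁ → S}
    (h₀ : IsNormalNorm ν₀) (h₁ : IsNormalNorm ν₁) (f₀ : A →* B₀) (f₁ : A →* B₁)
    (hf : ∀ a, ν₀ (f₀ a) = ν₁ (f₁ a)) :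
    ∃ (C : Type u) (_ : Group C) (μ : C → S) (g₀ : B₀ →* C) (g₁ : B₁ →* C),
      IsFinProdAlternating C ∧ IsNormalNorm μ ∧ (∀ b, μ (g₀ b) = ν₀ b) ∧ (∀ b, μ (g₁ b) = ν₁ b) ∧
      (∀ a, g₀ (f₀ a) = g₁ (f₁ a)) ∧
      ∀ (x : B₁) (Y : Finset B₁), ν₁ x ≤ Y.sup ν₁ → g₁ x ∈ Subgroup.normalClosure (g₁ '' Y) := by
  classical
  obtain ⟨J, _, θ, s, hs, hν, hθ⟩ := hS.exists_boolean_lift (Sum.elim ν₀ ν₁)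
  have le_imp : ∀ x y, Sum.elim ν₀ ν₁ x ≤ Sum.elim ν₀ ν₁ y → ∀ j ∈ θ x, j ∈ θ y := by
    intro x y hxy j hj
    simpa using hθ x {y} (by simpa using hxy) j hj
  have le_sup_imp : ∀ x y z, Sum.elim ν₀ ν₁ x ≤ Sum.elim ν₀ ν₁ y ⊔ Sum.elim ν₀ ν₁ z →
      ∀ j ∈ θ x, j ∈ θ y ∨ j ∈ θ z := by
    intro x y z h j hj
    simpa using hθ x {y, z} (by simpa using h) j hj
  have bot_imp : ∀ x, Sum.elim ν₀ ν₁ x = ⊥ → ∀ j, j ∉ θ x := by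
    intro x h j hj
    simpa using hθ x ∅ (by simp [h]) j hj
  -- The subgroup and normality axioms are join relations between norms, so they hold coordinatewise
  -- for `θ`.
  let N₀ : J → Subgroup B₀ := fun j =>
    { carrier := {b | j ∉ θ (Sum.inl b)}
      one_mem' := bot_imp (Sum.inl 1) h₀.one j
      mul_mem' := fun {x y} hx hy h =>
        (le_sup_imp (Sum.inl (x * y)) (Sum.inl x) (Sum.inl y) (h₀.mul_le x y) j h).elim hx hy
      inv_mem' := fun {x} hx h => hx (le_imp (Sum.inl x⁻¹) (Sum.inl x) (h₀.inv x).le j h) }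
  let N₁ : J → Subgroup B₁ := fun j =>
    { carrier := {b | j ∉ θ (Sum.inr b)}
      one_mem' := bot_imp (Sum.inr 1) h₁.one j
      mul_mem' := fun {x y} hx hy h =>
        (le_sup_imp (Sum.inr (x * y)) (Sum.inr x) (Sum.inr y) (h₁.mul_le x y) j h).elim hx hy
      inv_mem' := fun {x} hx h => hx (le_imp (Sum.inr x⁻¹) (Sum.inr x) (h₁.inv x).le j h) }
  have hN₀ : ∀ j, (N₀ j).Normal := fun j =>
    ⟨fun x hx y h => hx (le_imp (Sum.inl (y * x * y⁻¹)) (Sum.inl x) (h₀.conj x y).le j h)⟩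
  have hN₁ : ∀ j, (N₁ j).Normal := fun j =>
    ⟨fun x hx y h => hx (le_imp (Sum.inr (y * x * y⁻¹)) (Sum.inr x) (h₁.conj x y).le j h)⟩
  have hker : ∀ j, ((QuotientGroup.mk' (N₀ j)).comp f₀).ker =
      ((QuotientGroup.mk' (N₁ j)).comp f₁).ker := by
    intro j
    ext a
    simp only [MonoidHom.mem_ker, MonoidHom.comp_apply, QuotientGroup.mk'_apply,
      QuotientGroup.eq_one_iff]
    -- Both images of `a` have the same norm, so `θ` takes the same value on them.
    exact not_congr ⟨le_imp (Sum.inl (f₀ a)) (Sum.inr (f₁ a)) (hf a).le j,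
      le_imp (Sum.inr (f₁ a)) (Sum.inl (f₀ a)) (hf a).ge j⟩
  choose n hn k₀ k₁ hk₀ hk₁ hk using fun j => exists_perm_amalgam _ _ (hker j)
  let g₀ : B₀ →* (j : J) → alternatingGroup (Fin (n j)) :=
    MonoidHom.pi fun j => (k₀ j).comp (QuotientGroup.mk' (N₀ j))
  let g₁ : B₁ →* (j : J) → alternatingGroup (Fin (n j)) :=
    MonoidHom.pi fun j => (k₁ j).comp (QuotientGroup.mk' (N₁ j))
  have hg₀ : ∀ b j, g₀ b j ≠ 1 ↔ j ∈ θ (Sum.inl b) := by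
    intro b j
    change k₀ j (b : B₀ ⧸ N₀ j) ≠ 1 ↔ _
    rw [Ne, map_eq_one_iff _ (hk₀ j), QuotientGroup.eq_one_iff]
    exact not_not
  have hg₁ : ∀ b j, g₁ b j ≠ 1 ↔ j ∈ θ (Sum.inr b) := by
    intro b j
    change k₁ j (b : B₁ ⧸ N₁ j) ≠ 1 ↔ _
    rw [Ne, map_eq_one_iff _ (hk₁ j), QuotientGroup.eq_one_iff]
    exact not_not
  -- By `hg₀` and `hg₁` the support of the image of `b` is its `θ`-set, so the support norm
  -- restricts to `ν₀` and `ν₁`.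
  refine ⟨(j : J) → alternatingGroup (Fin (n j)), inferInstance, _, g₀, g₁,
    isFinProdAlternating_pi n hn, isNormalNorm_pi s hs, ?_, ?_, ?_, ?_⟩
  · intro b
    simp only [hg₀, Finset.filter_univ_mem]
    exact (hν (Sum.inl b)).symm
  · intro b
    simp only [hg₁, Finset.filter_univ_mem]
    exact (hν (Sum.inr b)).symm
  · intro a
    funext j
    exact hk j a
  · intro x Y hxY
    have : ∀ j, IsSimpleGroup (alternatingGroup (Fin (n j))) := fun j =>
      alternatingGroup.isSimpleGroup (by simpa using hn j)
    refine mem_normalClosure_pi (fun j => alternatingGroup.center_eq_bot ?_) _ _ fun j hj => ?_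
    · have := hn j
      simp
      omega
    · obtain ⟨y, hy, hyj⟩ := hθ (Sum.inr x) (Y.map ⟨Sum.inr, Sum.inr_injective⟩)
        (by simpa [Finset.sup_map, Function.comp_def] using hxY) j ((hg₁ x j).1 hj)
      obtain ⟨z, hz, rfl⟩ := Finset.mem_map.1 hy
      exact ⟨g₁ z, ⟨z, hz, rfl⟩, (hg₁ z j).2 hyj⟩

end Norm

/-! ### Normed direct limits and local products of alternating groups. -/

section Limits

variable {S : Type u} [SemilatticeSup S] [OrderBot S]

open DirectLimit in
theorem exists_isNormalNorm_directLimit {ι : Type*} [Preorder ι] [IsDirectedOrder ι] [Nonempty ι]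
    {B : ι → Type u} [∀ i, Group (B i)] (f : ∀ i j, i ≤ j → B i →* B j)
    [DirectedSystem B fun i j h => f i j h] (ν : ∀ i, B i → S) (hν : ∀ i, IsNormalNorm (ν i))
    (hf : ∀ i j h x, ν j (f i j h x) = ν i x) :
    ∃ (μ : DirectLimit B f → S), IsNormalNorm μ ∧ ∃ φ : ∀ i, B i →* DirectLimit B f,
      (∀ i x, μ (φ i x) = ν i x) ∧ (∀ i j h x, φ j (f i j h x) = φ i x) ∧
      ∀ y, ∃ i x, φ i x = y := by
  refine ⟨DirectLimit.lift f ν fun i j h x => (hf i j h x).symm, ⟨?_, ?_, ?_, ?_⟩,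
    fun i => ⟨⟨fun x => ⟦⟨i, x⟩⟧, (one_def i).symm⟩, fun x y => (mul_def i x y).symm⟩, ?_, ?_, ?_⟩
  · refine DirectLimit.induction _ fun i x => ?_
    rw [lift_def, (hν i).eq_bot_iff]
    constructor
    · rintro rfl
      exact (one_def i).symm
    · intro h
      obtain ⟨j, hij, _, hj⟩ := Quotient.exact (h.trans (one_def i))
      have : f i j hij x = 1 := hj.trans (map_one _)
      rw [← (hν i).eq_bot_iff, ← hf i j hij, this, (hν j).one]
  · refine DirectLimit.induction₂ _ fun i x y => ?_
    rw [mul_def]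
    exact (hν i).mul_le x y
  · refine DirectLimit.induction _ fun i x => (hν i).inv x
  · refine DirectLimit.induction₂ _ fun i x y => ?_
    rw [inv_def, mul_def, mul_def]
    exact (hν i).conj x y
  · intro i x
    rfl
  · intro i j h x
    exact (eq_of_le (f := f) ⟨i, x⟩ j h).symm
  · intro y
    obtain ⟨i, x, rfl⟩ := exists_eq_mk f y
    exact ⟨i, x, rfl⟩

theorem exists_isNormalNorm_sequence_limit (B : ℕ → Type u) [∀ n, Group (B n)]
    (g : ∀ n, B n →* B (n + 1)) (ν : ∀ n, B n → S) (hν : ∀ n, IsNormalNorm (ν n))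
    (hg : ∀ n x, ν (n + 1) (g n x) = ν n x) :
    ∃ (H : Type u) (_ : Group H) (μ : H → S), IsNormalNorm μ ∧ ∃ φ : ∀ n, B n →* H,
      (∀ n x, μ (φ n x) = ν n x) ∧ (∀ n x, φ (n + 1) (g n x) = φ n x) ∧ ∀ y, ∃ n x, φ n x = y := by
  let f : ∀ m n, m ≤ n → B m →* B n := fun m n h =>
    Nat.leRec (motive := fun n _ => B m →* B n) (MonoidHom.id _) (fun k _ F => (g k).comp F) h
  have f_self : ∀ m x, f m m le_rfl x = x := fun m x => by simp [f, Nat.leRec_self]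
  have f_succ : ∀ m n (h : m ≤ n) x, f m (n + 1) (h.trans n.le_succ) x = g n (f m n h x) :=
    fun m n h x => by simp only [f]; rw [Nat.leRec_succ _ _ h]; rfl
  have : DirectedSystem B fun m n h => f m n h :=
    ⟨fun m x => f_self m x, fun k j i hij hjk x => by
      induction k, hjk using Nat.le_induction with
      | base => exact f_self _ _
      | succ k hk ih => rw [f_succ j k hk, f_succ i k (hij.trans hk), ih]⟩
  have hf : ∀ i j h x, ν j (f i j h x) = ν i x := by
    intro i j h x
    induction j, h using Nat.le_induction with
    | base => rw [f_self]
    | succ k hk ih => rw [f_succ i k hk, hg, ih]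
  obtain ⟨μ, hμ, φ, h1, h2, h3⟩ := exists_isNormalNorm_directLimit f ν hν hf
  refine ⟨_, inferInstance, μ, hμ, φ, h1, fun n x => ?_, h3⟩
  rw [← h2 n (n + 1) n.le_succ x, f_succ n n le_rfl, f_self]

end Limits

/-- Every finite subset is contained in a subgroup that is a finite product of alternating groups
of degrees at least `5`. -/
def IsLocallyFinProdAlternating (G : Type u) [Group G] : Prop :=
  ∀ T : Finset G, ∃ K : Subgroup G, (∀ x ∈ T, x ∈ K) ∧ IsFinProdAlternating K

theorem IsLocallyFinProdAlternating.isLocallyFiniteGroup {G : Type u} [Group G]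
    (hG : IsLocallyFinProdAlternating G) : IsLocallyFiniteGroup G := by
  rintro H ⟨T, rfl⟩
  obtain ⟨K, hTK, hK⟩ := hG T
  have := hK.finite
  exact Finite.of_injective _ (Subgroup.inclusion_injective ((Subgroup.closure_le K).2 hTK))

theorem map_mem_normalClosure {G H : Type*} [Group G] [Group H] (f : G →* H) {s : Set G} {x : G}
    (hx : x ∈ Subgroup.normalClosure s) : f x ∈ Subgroup.normalClosure (f '' s) := by
  have hn : ((Subgroup.normalClosure (f '' s)).comap f).Normal :=
    Subgroup.Normal.comap Subgroup.normalClosure_normal _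
  exact Subgroup.normalClosure_le_normal (N := (Subgroup.normalClosure (f '' s)).comap f)
    (fun y hy => Subgroup.subset_normalClosure ⟨y, hy, rfl⟩) hx

theorem exists_monoidHom_of_sequence {G H : Type*} [Group G] [Group H] (A : ℕ → Subgroup G)
    (hA : Monotone A) (hcov : ∀ x, ∃ n, x ∈ A n) (θ : ∀ n, A n →* H)
    (hθ : ∀ n x, θ (n + 1) (Subgroup.inclusion (hA n.le_succ) x) = θ n x) :
    ∃ ψ : G →* H, ∀ n (x : A n), ψ x = θ n x := by
  have key : ∀ m n (h : m ≤ n) (x : A m), θ n (Subgroup.inclusion (hA h) x) = θ m x := by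
    intro m n h x
    induction n, h using Nat.le_induction with
    | base => rfl
    | succ k hk ih => exact (hθ k (Subgroup.inclusion (hA hk) x)).trans ih
  choose N hN using hcov
  have hψ : ∀ n (x : A n), θ (N x) ⟨x, hN x⟩ = θ n x := by
    intro n x
    rcases le_total n (N x) with h | h
    · exact key n _ h x
    · exact (key _ n h ⟨x, hN x⟩).symm
  refine ⟨⟨⟨fun x => θ (N x) ⟨x, hN x⟩, ?_⟩, ?_⟩, hψ⟩
  · exact (hψ (N 1) 1).trans (map_one _)
  · intro x y
    let n := max (N x) (N y)
    let x' : A n := ⟨x, hA (le_max_left _ _) (hN x)⟩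
    let y' : A n := ⟨y, hA (le_max_right _ _) (hN y)⟩
    exact (hψ n (x' * y')).trans ((map_mul _ _ _).trans
      (congrArg₂ (· * ·) (hψ n x').symm (hψ n y').symm))

/-! ### Extending a countable normed group. -/

section Extension

variable {S : Type u} [SemilatticeSup S] [OrderBot S]

/-- A finite normed group together with a norm-preserving homomorphism from a given one. -/
structure NormedOver {A : Type u} [Group A] (α : A → S) where
  /-- the underlying group -/
  grp : Type u
  [instGroup : Group grp]
  [instFinite : Finite grp]
  /-- the norm -/
  norm : grp → S
  isNormalNorm : IsNormalNorm norm
  /-- the structure homomorphism -/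
  hom : A →* grp
  norm_hom : ∀ a, norm (hom a) = α a

attribute [instance] NormedOver.instGroup NormedOver.instFinite

/-- One rung of a ladder: `A'`, with the norm of `G`, is amalgamated with `σ` over `A`. Taking `σ`
as the second group makes the inequalities coming from `A` witnessed. -/
theorem IsDistribSemilattice.exists_normedOver (hS : IsDistribSemilattice S) {G : Type u} [Group G]
    {ν : G → S} (hν : IsNormalNorm ν) {A A' : Subgroup G} (h : A ≤ A') [Finite A']
    (σ : NormedOver fun a : A => ν a) :
    ∃ (τ : NormedOver fun a : A' => ν a) (g : σ.grp →* τ.grp),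
      IsFinProdAlternating τ.grp ∧ (∀ x, τ.norm (g x) = σ.norm x) ∧
      (∀ a, τ.hom (Subgroup.inclusion h a) = g (σ.hom a)) ∧
      ∀ (x : A) (Y : Finset A), ν x ≤ Y.sup (fun y => ν y) →
        g (σ.hom x) ∈ Subgroup.normalClosure ((fun y => g (σ.hom y)) '' Y) := by
  classical
  obtain ⟨C, _, μ, g₀, g₁, hC, hμ, h0, h1, hg, ht⟩ := hS.exists_amalgam
    (hν.comp A'.subtype A'.subtype_injective) σ.isNormalNorm (Subgroup.inclusion h) σ.hom
    fun a => (σ.norm_hom a).symm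
  have := hC.finite
  refine ⟨⟨C, μ, hμ, g₀, h0⟩, g₁, hC, h1, hg, fun x Y hxY => ?_⟩
  have := ht (σ.hom x) (Y.image σ.hom) (by
    simpa [Finset.sup_image, Function.comp_def, σ.norm_hom] using hxY)
  rwa [Finset.coe_image, Set.image_image] at this

/-- Supplies the starting rung, where the value `s` is planted. A group of order two serves unless
`s = ⊥`, a value that only the identity may take. -/
theorem exists_normedOver_bot {G : Type u} [Group G] {ν : G → S} (hν : IsNormalNorm ν)
    {A : Subgroup G} (hA : A = ⊥) (s : S) :
    ∃ σ : NormedOver (fun a : A => ν a), ∃ x, σ.norm x = s := by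
  classical
  have h1 : ∀ a : A, ν a = ⊥ := by
    rintro ⟨a, ha⟩
    rw [hA, Subgroup.mem_bot] at ha
    exact (hν.eq_bot_iff a).2 ha
  by_cases hs : s = ⊥
  · refine ⟨⟨PUnit, fun _ => ⊥, ⟨by simp, by simp, by simp, by simp⟩, 1, ?_⟩, 1, hs.symm⟩
    simp [h1]
  · refine ⟨⟨Equiv.Perm (ULift.{u} Bool), fun x => if x = 1 then ⊥ else s,
      ⟨?_, ?_, ?_, ?_⟩, 1, ?_⟩, Equiv.swap ⟨true⟩ ⟨false⟩, ?_⟩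
    · intro x
      by_cases hx : x = 1 <;> simp [hx, hs]
    · intro x y
      by_cases hx : x = 1
      · simp [hx]
      · simp only [hx, if_false]
        exact le_sup_of_le_left (by split_ifs <;> simp)
    · simp
    · intro x y
      simp [mul_inv_eq_one]
    · simp [h1]
    · simp

/-- A countable locally finite normed group extends to a countable normed group that is locally a
product of alternating groups, in which a given value is attained and all inequalities
between norms in the small group are witnessed by normal closures. -/
theorem IsDistribSemilattice.exists_extension (hS : IsDistribSemilattice S) {G : Type u} [Group G]
    [Countable G] {ν : G → S} (hν : IsNormalNorm ν) (hG : IsLocallyFiniteGroup G) (s : S) :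
    ∃ (H : Type u) (_ : Group H) (μ : H → S) (ψ : G →* H), Countable H ∧ IsNormalNorm μ ∧
      IsLocallyFinProdAlternating H ∧ (∀ x, μ (ψ x) = ν x) ∧ (∃ y, μ y = s) ∧
      ∀ (x : G) (Y : Finset G), ν x ≤ Y.sup ν → ψ x ∈ Subgroup.normalClosure (ψ '' Y) := by
  classical
  obtain ⟨e, he⟩ := exists_surjective_nat G
  let A : ℕ → Subgroup G := fun n => Subgroup.closure (e '' Set.Iio n)
  have hA : Monotone A := fun m n h =>
    Subgroup.closure_mono (Set.image_mono (Set.Iio_subset_Iio h))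
  have hAfin : ∀ n, Finite (A n) := fun n =>
    hG _ ((Subgroup.fg_iff _).2 ⟨_, rfl, (Set.finite_Iio n).image e⟩)
  have hAcov : ∀ x, ∃ n, x ∈ A n := fun x => by
    obtain ⟨n, rfl⟩ := he x
    exact ⟨n + 1, Subgroup.subset_closure ⟨n, n.lt_succ_self, rfl⟩⟩
  have hAfin_cov : ∀ T : Finset G, ∃ n, ∀ x ∈ T, x ∈ A n := by
    intro T
    choose N hN using hAcov
    exact ⟨T.sup N, fun x hx => hA (Finset.le_sup hx) (hN x)⟩
  have hA0 : A 0 = ⊥ := by simp [A]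
  choose next g hF hg_norm hg_hom hg_task using
    fun (n : ℕ) (σ : NormedOver fun a : A n => ν a) => hS.exists_normedOver hν (hA n.le_succ) σ
  obtain ⟨σ₀, x₀, hx₀⟩ := exists_normedOver_bot hν hA0 s
  -- The rung at `n + 1` amalgamates `A (n + 1)` with the rung at `n` over `A n`.
  let σ : ∀ n, NormedOver fun a : A n => ν a := fun n =>
    Nat.rec (motive := fun n => NormedOver fun a : A n => ν a) σ₀ (fun n τ => next n τ) n
  obtain ⟨H, _, μ, hμ, φ, h1, h2, h3⟩ := exists_isNormalNorm_sequence_limit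
    (fun n => (σ n).grp) (fun n => g n (σ n)) (fun n => (σ n).norm) (fun n => (σ n).isNormalNorm)
    (fun n => hg_norm n (σ n))
  obtain ⟨ψ, hψ⟩ := exists_monoidHom_of_sequence A hA hAcov (fun n => (φ n).comp (σ n).hom) (by
    intro n x
    change φ (n + 1) ((next n (σ n)).hom _) = φ n ((σ n).hom x)
    rw [hg_hom]
    exact h2 n _)
  have φ_range : ∀ m n, m ≤ n → (φ m).range ≤ (φ n).range := by
    intro m n h
    induction n, h using Nat.le_induction with
    | base => exact le_rfl
    | succ k _ ih =>
      refine ih.trans ?_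
      rintro _ ⟨x, rfl⟩
      exact ⟨_, h2 k x⟩
  refine ⟨H, inferInstance, μ, ψ, ?_, hμ, ?_, ?_, ⟨φ 0 x₀, (h1 0 x₀).trans hx₀⟩, ?_⟩
  · have : Function.Surjective fun p : (n : ℕ) × (σ n).grp => φ p.1 p.2 := fun y => by
      obtain ⟨n, x, hx⟩ := h3 y
      exact ⟨⟨n, x⟩, hx⟩
    have : ∀ n, Countable (σ n).grp := fun n => Finite.to_countable
    exact Function.Surjective.countable ‹Function.Surjective _›
  · intro T
    choose N b hb using h3
    -- The `+ 1` is needed because only successor rungs are known to be products of alternating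
    -- groups.
    have hinj : Function.Injective (φ (T.sup N + 1)) :=
      (σ (T.sup N + 1)).isNormalNorm.injective_of_comp hμ _ (h1 (T.sup N + 1))
    refine ⟨(φ (T.sup N + 1)).range, fun y hy => ?_,
      IsFinProdAlternating.of_mulEquiv (hF (T.sup N) (σ (T.sup N)))
        (MonoidHom.ofInjective hinj).symm⟩
    exact φ_range (N y) _ ((Finset.le_sup hy).trans (Nat.le_succ _)) ⟨b y, hb y⟩
  · intro x
    obtain ⟨n, hn⟩ := hAcov x
    rw [hψ n ⟨x, hn⟩]
    exact (h1 n _).trans ((σ n).norm_hom _)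
  · intro x Y hxY
    obtain ⟨n, hn⟩ := hAfin_cov (insert x Y)
    have hx := hn x (Finset.mem_insert_self _ _)
    have hY : ∀ y ∈ Y, y ∈ A n := fun y hy => hn y (Finset.mem_insert_of_mem hy)
    have h := map_mem_normalClosure (φ (n + 1)) (hg_task n (σ n) ⟨x, hx⟩ (Y.subtype (· ∈ A n)) (by
      refine hxY.trans (Finset.sup_le fun y hy => ?_)
      exact Finset.le_sup (f := fun y : A n => ν y) (b := ⟨y, hY y hy⟩) (by simpa using hy)))
    have hval : ∀ y : A n, φ (n + 1) (g n (σ n) ((σ n).hom y)) = ψ y := fun y => by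
      rw [hψ n y]
      exact h2 n _
    rw [Set.image_image] at h
    simp only [hval] at h
    refine Subgroup.normalClosure_mono ?_ h
    rintro _ ⟨y, hy, rfl⟩
    exact ⟨y, by simpa using hy, rfl⟩

end Extension

/-! ### Normed groups inside a fixed set, so that extensions are literal inclusions. -/

/-- A group structure with a norm on a subset of a fixed type. -/
structure NormedGroupOn (Ω S : Type u) [SemilatticeSup S] [OrderBot S] where
  /-- the underlying set -/
  carrier : Set Ω
  [instGroup : Group carrier]
  /-- the norm -/
  norm : carrier → S
  isNormalNorm : IsNormalNorm norm

attribute [instance] NormedGroupOn.instGroup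

namespace NormedGroupOn

variable {Ω S : Type u} [SemilatticeSup S] [OrderBot S]

/-- `p ≤ q` if `p` is a subgroup of `q` with the restricted norm. -/
instance : Preorder (NormedGroupOn Ω S) where
  le p q := ∃ φ : p.carrier →* q.carrier, (∀ x, (φ x : Ω) = x) ∧ ∀ x, q.norm (φ x) = p.norm x
  le_refl p := ⟨MonoidHom.id _, fun _ => rfl, fun _ => rfl⟩
  le_trans p q r := by
    rintro ⟨φ, h1, h2⟩ ⟨ψ, h3, h4⟩
    exact ⟨ψ.comp φ, fun x => (h3 _).trans (h1 x), fun x => (h4 _).trans (h2 x)⟩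

/-- The inclusion homomorphism. -/
noncomputable def inclusion {p q : NormedGroupOn Ω S} (h : p ≤ q) : p.carrier →* q.carrier :=
  h.choose

@[simp]
theorem coe_inclusion {p q : NormedGroupOn Ω S} (h : p ≤ q) (x : p.carrier) :
    (inclusion h x : Ω) = x :=
  h.choose_spec.1 x

@[simp]
theorem norm_inclusion {p q : NormedGroupOn Ω S} (h : p ≤ q) (x : p.carrier) :
    q.norm (inclusion h x) = p.norm x :=
  h.choose_spec.2 x

theorem inclusion_injective {p q : NormedGroupOn Ω S} (h : p ≤ q) :
    Function.Injective (inclusion h) := fun x y hxy => Subtype.ext <| by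
  rw [← coe_inclusion h x, hxy, coe_inclusion]

@[simp]
theorem inclusion_inclusion {p q r : NormedGroupOn Ω S} (h : p ≤ q) (h' : q ≤ r) (x : p.carrier) :
    inclusion h' (inclusion h x) = inclusion (h.trans h') x := Subtype.ext (by simp)

/-- Transport of a normed group along an injection into `Ω`. -/
theorem exists_of_injective {H : Type u} [Group H] {μ : H → S} (hμ : IsNormalNorm μ) (e : H → Ω)
    (he : Function.Injective e) :
    ∃ (q : NormedGroupOn Ω S) (ε : H ≃* q.carrier),
      (∀ x, (ε x : Ω) = e x) ∧ ∀ x, q.norm (ε x) = μ x := by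
  let E := Equiv.ofInjective e he
  let _ : Group (Set.range e) := E.symm.group
  let ε : H ≃* Set.range e := (E.symm.mulEquiv).symm
  refine ⟨⟨Set.range e, fun y => μ (ε.symm y), hμ.comp ε.symm.toMonoidHom ε.symm.injective⟩, ε,
    fun x => rfl, fun x => ?_⟩
  exact congrArg μ (ε.symm_apply_apply x)

/-- Extensions of countable groups can be realized inside an uncountable type. -/
theorem exists_ge_of_hom [Uncountable Ω] (p : NormedGroupOn Ω S) (hp : p.carrier.Countable)
    {H : Type u} [Group H] [Countable H] {μ : H → S} (hμ : IsNormalNorm μ)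
    (ψ : p.carrier →* H) (hψ : ∀ x, μ (ψ x) = p.norm x) :
    ∃ (q : NormedGroupOn Ω S) (ε : H ≃* q.carrier) (h : p ≤ q),
      (∀ x, q.norm (ε x) = μ x) ∧ ∀ x, ε (ψ x) = inclusion h x := by
  have hinj := p.isNormalNorm.injective_of_comp hμ ψ hψ
  have hinf : Infinite (p.carrierᶜ : Set Ω) := by
    rw [Set.infinite_coe_iff]
    intro hfin
    exact Set.not_countable_univ (by
      rw [← Set.union_compl_self p.carrier]
      exact hp.union hfin.countable)
  obtain ⟨c, hc⟩ := Countable.exists_injective_nat H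
  let k : H → (p.carrierᶜ : Set Ω) := fun x => Infinite.natEmbedding _ (c x)
  have hk : Function.Injective k := (Infinite.natEmbedding _).injective.comp hc
  -- Elements from `p` keep their place; the new ones go into the complement, which is infinite
  -- since `Ω` is uncountable and `p` countable.
  let e : H → Ω := Function.extend ψ Subtype.val fun x => k x
  have e1 : ∀ x, e (ψ x) = x := fun x => hinj.extend_apply _ _ x
  have e2 : ∀ y, (¬ ∃ x, ψ x = y) → e y = k y := fun y hy => Function.extend_apply' _ _ y hy
  have he : Function.Injective e := by
    intro y z hyz
    by_cases hy : ∃ x, ψ x = y <;> by_cases hz : ∃ x, ψ x = z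
    · obtain ⟨x, rfl⟩ := hy
      obtain ⟨x', rfl⟩ := hz
      rw [e1, e1] at hyz
      rw [Subtype.ext hyz]
    · obtain ⟨x, rfl⟩ := hy
      rw [e1, e2 z hz] at hyz
      exact absurd (hyz ▸ x.2) (k z).2
    · obtain ⟨x, rfl⟩ := hz
      rw [e1, e2 y hy] at hyz
      exact absurd (hyz ▸ x.2) (k y).2
    · rw [e2 y hy, e2 z hz] at hyz
      exact hk (Subtype.ext hyz)
  obtain ⟨q, ε, h1, h2⟩ := exists_of_injective hμ e he
  have hle : p ≤ q := ⟨ε.toMonoidHom.comp ψ, fun x => (h1 _).trans (e1 x),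
    fun x => (h2 _).trans (hψ x)⟩
  refine ⟨q, ε, hle, h2, fun x => Subtype.ext ?_⟩
  rw [coe_inclusion, h1, e1]

/-- Directed families have unions. -/
theorem exists_union {I : Type u} [Preorder I] [IsDirectedOrder I] [Nonempty I]
    (p : I → NormedGroupOn Ω S) (hp : Monotone p) :
    ∃ q : NormedGroupOn Ω S, (∀ i, p i ≤ q) ∧ q.carrier = ⋃ i, (p i).carrier := by
  let f : ∀ i j, i ≤ j → (p i).carrier →* (p j).carrier := fun i j h => inclusion (hp h)
  have : DirectedSystem (fun i => (p i).carrier) fun i j h => f i j h :=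
    ⟨fun i x => Subtype.ext (coe_inclusion _ _), fun k j i hij hjk x => inclusion_inclusion _ _ _⟩
  obtain ⟨μ, hμ, φ, h1, h2, h3⟩ := exists_isNormalNorm_directLimit f (fun i => (p i).norm)
    (fun i => (p i).isNormalNorm) (fun i j h x => norm_inclusion _ _)
  have hφ : ∀ i j (x : (p i).carrier) (y : (p j).carrier), φ i x = φ j y ↔ (x : Ω) = y := by
    intro i j x y
    obtain ⟨k, hik, hjk⟩ := exists_ge_ge i j
    rw [← h2 i k hik, ← h2 j k hjk,
      ((p k).isNormalNorm.injective_of_comp hμ _ (h1 k)).eq_iff, Subtype.ext_iff]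
    simp [f]
  -- By `hφ` the point of `Ω` underlying a representative depends only on its class, so the limit
  -- embeds into `Ω` with image the union.
  choose N b hb using h3
  obtain ⟨q, ε, hε, hq⟩ := exists_of_injective hμ (fun y => (b y : Ω)) (by
    intro y z hyz
    rw [← hb y, ← hb z]
    exact (hφ _ _ _ _).2 hyz)
  have hval : ∀ i (x : (p i).carrier), (ε (φ i x) : Ω) = x := fun i x => by
    rw [hε, ← hφ (N (φ i x)) i, hb]
  refine ⟨q, fun i => ⟨ε.toMonoidHom.comp (φ i), hval i, fun x => (hq _).trans (h1 i x)⟩, ?_⟩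
  ext w
  rw [Set.mem_iUnion]
  constructor
  · intro hw
    obtain ⟨y, hy⟩ := ε.surjective ⟨w, hw⟩
    have : w = b y := by rw [← hε, hy]
    exact ⟨N y, this ▸ (b y).2⟩
  · rintro ⟨i, hi⟩
    have hw : (ε (φ i ⟨w, hi⟩) : Ω) = w := hval i ⟨w, hi⟩
    exact hw ▸ (ε (φ i ⟨w, hi⟩)).2

theorem exists_finset_eq_image {I : Type*} [Preorder I] [IsDirectedOrder I] [Nonempty I]
    {p : I → NormedGroupOn Ω S} (hp : Monotone p) {q : NormedGroupOn Ω S} (hpq : ∀ i, p i ≤ q)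
    (hq : q.carrier = ⋃ i, (p i).carrier)
    (T : Finset q.carrier) :
    ∃ i, ∀ x ∈ T, ∃ y, inclusion (hpq i) y = x := by
  have hcov : ∀ x : q.carrier, ∃ i, (x : Ω) ∈ (p i).carrier := fun x => by
    rw [← Set.mem_iUnion, ← hq]
    exact x.2
  choose N hN using hcov
  classical
  obtain ⟨i, hi⟩ := (T.image N).exists_le
  refine ⟨i, fun x hx => ?_⟩
  have hle := hp (hi _ (Finset.mem_image_of_mem N hx))
  exact ⟨inclusion hle ⟨x, hN x⟩, Subtype.ext (by simp)⟩

theorem isLocallyFiniteGroup_of_union {I : Type*} [Preorder I] [IsDirectedOrder I] [Nonempty I]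
    {p : I → NormedGroupOn Ω S} (hp : Monotone p) {q : NormedGroupOn Ω S} (hpq : ∀ i, p i ≤ q)
    (hq : q.carrier = ⋃ i, (p i).carrier)
    (h : ∀ i, IsLocallyFiniteGroup (p i).carrier) :
    IsLocallyFiniteGroup q.carrier := by
  rintro H ⟨T, rfl⟩
  obtain ⟨i, hi⟩ := exists_finset_eq_image hp hpq hq T
  classical
  choose! b hb using hi
  have hfin := h i (Subgroup.closure (T.image b)) ⟨_, rfl⟩
  have hle : Subgroup.closure (T : Set q.carrier) ≤
      (Subgroup.closure (T.image b : Set (p i).carrier)).map (inclusion (hpq i)) := by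
    rw [Subgroup.closure_le]
    intro x hx
    exact ⟨b x, Subgroup.subset_closure (Finset.mem_coe.2 (Finset.mem_image_of_mem b hx)), hb x hx⟩
  have : Finite ((Subgroup.closure (T.image b : Set (p i).carrier)).map (inclusion (hpq i))) :=
    Set.Finite.image _ hfin
  exact Finite.of_injective _ (Subgroup.inclusion_injective hle)

theorem isLocallyFinProdAlternating_of_union {I : Type*} [Preorder I] [IsDirectedOrder I] [Nonempty I]
    {p : I → NormedGroupOn Ω S} (hp : Monotone p) {q : NormedGroupOn Ω S} (hpq : ∀ i, p i ≤ q)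
    (hq : q.carrier = ⋃ i, (p i).carrier)
    (h : ∀ i, IsLocallyFinProdAlternating (p i).carrier) :
    IsLocallyFinProdAlternating q.carrier := by
  intro T
  obtain ⟨i, hi⟩ := exists_finset_eq_image hp hpq hq T
  classical
  choose! b hb using hi
  obtain ⟨K, hK, hF⟩ := h i (T.image b)
  exact ⟨K.map (inclusion (hpq i)),
    fun x hx => ⟨b x, hK _ (Finset.mem_image_of_mem b hx), hb x hx⟩,
    hF.of_mulEquiv (K.equivMapOfInjective _ (inclusion_injective (hpq i))).symm⟩

end NormedGroupOn

/-! ### The construction of length `ω₁`. -/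

/-- Transfinite recursion along a well-order with countable initial segments, in a preorder in
which countable chains are bounded. -/
theorem exists_monotone_of_countable_chain_bounded {ι P : Type*} [LinearOrder ι]
    [WellFoundedLT ι] [Preorder P] [Nonempty P] (hι : ∀ i : ι, (Set.Iio i).Countable)
    (hP : ∀ C : Set P, C.Countable → IsChain (· ≤ ·) C → C.Nonempty → ∃ u, ∀ c ∈ C, c ≤ u)
    (R : ι → P → P → Prop) (hR : ∀ i p, ∃ q, p ≤ q ∧ R i p q) :
    ∃ f : ι → P, Monotone f ∧ ∀ i, ∃ p, (∀ j < i, f j ≤ p) ∧ p ≤ f i ∧ R i p (f i) := by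
  classical
  choose ext hext hRext using hR
  have hub : ∀ C : Set P, ∃ u, C.Countable → IsChain (· ≤ ·) C → ∀ c ∈ C, c ≤ u := by
    intro C
    by_cases h : C.Countable ∧ IsChain (· ≤ ·) C ∧ C.Nonempty
    · obtain ⟨u, hu⟩ := hP C h.1 h.2.1 h.2.2
      exact ⟨u, fun _ _ => hu⟩
    -- A default bound makes `ub` total, as the recursion is defined before earlier values are known
    -- to form a chain. It also covers the empty set.
    · exact ⟨Classical.arbitrary P, fun h1 h2 c hc => absurd ⟨h1, h2, c, hc⟩ h⟩
  choose ub hub using hub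
  let f : ι → P := WellFoundedLT.fix fun i ih => ext i (ub {x | ∃ j, ∃ h : j < i, ih j h = x})
  have hf : ∀ i, f i = ext i (ub (f '' Set.Iio i)) := by
    intro i
    refine (WellFoundedLT.fix_eq _ i).trans ?_
    congr 2
    ext x
    simp [f]
  -- By induction the earlier values are monotone, hence a countable chain, so `ub` really bounds
  -- them.
  have hlt : ∀ i, ∀ j < i, f j ≤ ub (f '' Set.Iio i) := by
    intro i
    induction i using WellFoundedLT.induction with
    | ind i ih =>
      have hmono : ∀ j k, k < i → j < k → f j ≤ f k := fun j k hk hjk => by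
        rw [hf k]
        exact (ih k hk j hjk).trans (hext _ _)
      intro j hj
      refine hub _ ((hι i).image f) ?_ _ ⟨j, hj, rfl⟩
      rintro _ ⟨k, hk, rfl⟩ _ ⟨l, hl, rfl⟩ hne
      rcases lt_trichotomy k l with h | rfl | h
      · exact Or.inl (hmono k l hl h)
      · exact absurd rfl hne
      · exact Or.inr (hmono l k hk h)
  have hub_le : ∀ i, ub (f '' Set.Iio i) ≤ f i := fun i => by
    conv_rhs => rw [hf i]
    exact hext _ _
  refine ⟨f, fun i j hij => ?_, fun i => ⟨_, hlt i, hub_le i, ?_⟩⟩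
  · rcases hij.eq_or_lt with rfl | h
    · exact le_rfl
    · exact (hlt j i h).trans (hub_le j)
  · conv => arg 3; rw [hf i]
    exact hRext _ _

/-- Every distributive semilattice with at most `ℵ₁` elements is the range of a norm on a group
that is locally a product of alternating groups, such that inequalities between norms are witnessed
by normal closures. -/
theorem IsDistribSemilattice.exists_normed_group {S : Type u} [SemilatticeSup S] [OrderBot S]
    (hS : IsDistribSemilattice S) (hcard : #S ≤ ℵ₁) :
    ∃ (G : Type u) (_ : Group G) (ν : G → S), IsNormalNorm ν ∧ IsLocallyFinProdAlternating G ∧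
      Function.Surjective ν ∧
      ∀ (x : G) (Y : Finset G), ν x ≤ Y.sup ν → x ∈ Subgroup.normalClosure (Y : Set G) := by
  classical
  -- `Ω` is both the index order, of type `ω₁`, and the ambient set of the groups.
  let Ω : Type u := (ℵ₁ : Cardinal.{u}).ord.ToType
  have hΩ : #Ω = ℵ₁ := Cardinal.mk_ord_toType _
  have hIio : ∀ i : Ω, (Set.Iio i).Countable := fun i => by
    have h := Cardinal.mk_Iio_lt i (by rw [hΩ]; exact (Ordinal.type_toType _).symm)
    exact Cardinal.le_aleph0_iff_set_countable.1
      (Order.lt_succ_iff.1 (h.trans_eq (hΩ.trans Cardinal.succ_aleph0.symm)))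
  have : Uncountable Ω := by
    rw [← Cardinal.aleph0_lt_mk_iff, hΩ]
    exact Cardinal.aleph0_lt_aleph_one
  have hgt : ∀ i : Ω, ∃ j, i < j := fun i => by
    by_contra! h
    refine Set.not_countable_univ (α := Ω) (((hIio i).insert i).mono fun j _ => ?_)
    exact (h j).eq_or_lt.imp id id
  obtain ⟨s, hs⟩ : ∃ s : Ω → S, Function.Surjective s := by
    rw [← hΩ, Cardinal.le_def] at hcard
    obtain ⟨e⟩ := hcard
    have : Nonempty S := ⟨⊥⟩
    exact ⟨Function.invFun e, Function.invFun_surjective e.injective⟩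
  let P := {p : NormedGroupOn Ω S // p.carrier.Countable ∧ IsLocallyFiniteGroup p.carrier}
  have : Nonempty P := by
    have hμ : IsNormalNorm (fun _ : PUnit.{u + 1} => (⊥ : S)) :=
      ⟨by simp, by simp, by simp, by simp⟩
    obtain ⟨q, ε, -⟩ := NormedGroupOn.exists_of_injective hμ
      (fun _ => Classical.arbitrary Ω) (Function.injective_of_subsingleton _)
    have hfin : Finite q.carrier := Finite.of_equiv _ ε.toEquiv
    exact ⟨q, Set.to_countable _, fun H _ => inferInstance⟩
  have hP : ∀ C : Set P, C.Countable → IsChain (· ≤ ·) C → C.Nonempty → ∃ u, ∀ c ∈ C, c ≤ u := by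
    intro C hC hchain hne
    have : Nonempty C := hne.to_subtype
    have : Countable C := hC.to_subtype
    have : IsDirectedOrder C := directedOn_iff_isDirectedOrder.1 hchain.directedOn
    have hmono : Monotone fun c : C => c.1.1 := fun _ _ h => h
    obtain ⟨q, h1, h2⟩ := NormedGroupOn.exists_union (fun c : C => c.1.1) hmono
    refine ⟨⟨q, ?_, ?_⟩, fun c hc => h1 ⟨c, hc⟩⟩
    · rw [h2]
      exact Set.countable_iUnion fun c => c.1.2.1
    · exact NormedGroupOn.isLocallyFiniteGroup_of_union hmono h1 h2 fun c => c.1.2.2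
  obtain ⟨f, hmono, hf⟩ := exists_monotone_of_countable_chain_bounded hIio hP
    (fun i p q => (∃ y, q.1.norm y = s i) ∧ IsLocallyFinProdAlternating q.1.carrier ∧
      ∀ (h : p.1 ≤ q.1) (x : p.1.carrier) (Y : Finset p.1.carrier), p.1.norm x ≤ Y.sup p.1.norm →
        NormedGroupOn.inclusion h x ∈ Subgroup.normalClosure (NormedGroupOn.inclusion h '' Y)) (by
      rintro i ⟨p, hp, hpf⟩
      have : Countable p.carrier := hp.to_subtype
      obtain ⟨H, _, μ, ψ, hHc, hμ, hH, hψ, ⟨y, hy⟩, ht⟩ :=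
        hS.exists_extension p.isNormalNorm hpf (s i)
      obtain ⟨q, ε, hle, hq, hε⟩ := p.exists_ge_of_hom hp hμ ψ hψ
      have hqF : IsLocallyFinProdAlternating q.carrier := by
        intro T
        obtain ⟨K, hK, hF⟩ := hH (T.image ε.symm)
        exact ⟨K.map ε.toMonoidHom,
          fun x hx => ⟨ε.symm x, hK _ (Finset.mem_image_of_mem _ hx), ε.apply_symm_apply x⟩,
          hF.of_mulEquiv (K.equivMapOfInjective _ ε.injective).symm⟩
      have hqc : q.carrier.Countable := by
        rw [← Set.countable_coe_iff]
        exact ε.symm.injective.countable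
      refine ⟨⟨q, hqc, hqF.isLocallyFiniteGroup⟩, hle, ⟨ε y, (hq y).trans hy⟩, hqF,
        fun h x Y hxY => ?_⟩
      have := map_mem_normalClosure ε.toMonoidHom (ht x Y hxY)
      rw [Set.image_image] at this
      change ε (ψ x) ∈ Subgroup.normalClosure ((fun x => ε (ψ x)) '' Y) at this
      simpa only [hε] using this)
  have hmono' : Monotone fun i => (f i).1 := hmono
  obtain ⟨q, hle, hq⟩ := NormedGroupOn.exists_union (fun i => (f i).1) hmono'
  refine ⟨q.carrier, inferInstance, q.norm, q.isNormalNorm, ?_, ?_, ?_⟩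
  · refine NormedGroupOn.isLocallyFinProdAlternating_of_union hmono' hle hq fun i => ?_
    obtain ⟨_, -, -, -, h, -⟩ := hf i
    exact h
  · intro a
    obtain ⟨i, rfl⟩ := hs a
    obtain ⟨_, -, -, ⟨y, hy⟩, -⟩ := hf i
    exact ⟨NormedGroupOn.inclusion (hle i) y, by rw [NormedGroupOn.norm_inclusion, hy]⟩
  · intro x Y hxY
    obtain ⟨j, hj⟩ := NormedGroupOn.exists_finset_eq_image hmono' hle hq (insert x Y)
    choose! b hb using hj
    -- The finite set lies in stage `j`, hence in the group `p` that the later stage `i` extends; so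
    -- its inequality is witnessed in stage `i`.
    obtain ⟨i, hi⟩ := hgt j
    obtain ⟨p, hp, hpf, -, -, ht⟩ := hf i
    have hjp : (f j).1 ≤ p.1 := hp j hi
    have hval : ∀ y ∈ insert x Y, NormedGroupOn.inclusion (hle i)
        (NormedGroupOn.inclusion hpf (NormedGroupOn.inclusion hjp (b y))) = y := by
      intro y hy
      rw [NormedGroupOn.inclusion_inclusion, NormedGroupOn.inclusion_inclusion, hb y hy]
    have hnorm : ∀ y ∈ insert x Y, p.1.norm (NormedGroupOn.inclusion hjp (b y)) = q.norm y := by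
      intro y hy
      conv_rhs => rw [← hval y hy]
      simp only [NormedGroupOn.norm_inclusion]
    have h := map_mem_normalClosure (NormedGroupOn.inclusion (hle i))
      (ht hpf (NormedGroupOn.inclusion hjp (b x))
        (Y.image fun y => NormedGroupOn.inclusion hjp (b y)) (by
          rw [hnorm x (Finset.mem_insert_self _ _), Finset.sup_image]
          refine hxY.trans (Finset.sup_le fun y hy => ?_)
          rw [← hnorm y (Finset.mem_insert_of_mem hy)]
          exact Finset.le_sup
            (f := p.1.norm ∘ fun y => NormedGroupOn.inclusion hjp (b y)) hy))
    rw [hval x (Finset.mem_insert_self _ _)] at h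
    refine Subgroup.normalClosure_mono ?_ h
    rintro _ ⟨_, ⟨_, hz, rfl⟩, rfl⟩
    obtain ⟨y, hy, rfl⟩ := Finset.mem_image.1 hz
    rw [hval y (Finset.mem_insert_of_mem hy)]
    exact hy

/-- The subgroups in question are finite, so the union of two of them lies in a third: they form a
directed system of inclusions exhausting `G`. -/
theorem IsLocallyFinProdAlternating.isDirectLimit {G : Type u} [Group G]
    (hG : IsLocallyFinProdAlternating G) : IsDirectLimitOfFinProdAlternating G := by
  classical
  let ι := {K : Subgroup G // IsFinProdAlternating K}
  have hne : Nonempty ι := by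
    obtain ⟨K, -, hK⟩ := hG ∅
    exact ⟨⟨K, hK⟩⟩
  have hdir : IsDirectedOrder ι := ⟨by
    rintro ⟨K, hK⟩ ⟨L, hL⟩
    have := hK.finite
    have := hL.finite
    obtain ⟨M, hM, hF⟩ := hG ((Set.toFinite (K : Set G)).toFinset ∪
      (Set.toFinite (L : Set G)).toFinset)
    exact ⟨⟨M, hF⟩, fun x hx => hM x (by simp [SetLike.mem_coe.1 hx]),
      fun x hx => hM x (by simp [SetLike.mem_coe.1 hx])⟩⟩
  let f : ∀ i j : ι, i ≤ j → i.1 →* j.1 := fun i j h => Subgroup.inclusion h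
  have hsys : DirectedSystem (fun i : ι => i.1) fun i j h => f i j h :=
    ⟨fun _ _ => rfl, fun _ _ _ _ _ _ => rfl⟩
  let φ : DirectLimit (fun i : ι => i.1) f →* G :=
    { toFun := DirectLimit.lift f (fun i x => (x : G)) fun _ _ _ _ => rfl
      map_one' := by
        rw [DirectLimit.one_def (Classical.arbitrary ι)]
        rfl
      map_mul' := DirectLimit.induction₂ _ fun i x y => by
        rw [DirectLimit.mul_def]
        rfl }
  have hφ : Function.Bijective φ := by
    refine ⟨DirectLimit.lift_injective f _ (fun _ _ _ _ => rfl) fun i => Subtype.val_injective, fun x => ?_⟩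
    obtain ⟨K, hK, hF⟩ := hG {x}
    exact ⟨⟦⟨⟨K, hF⟩, ⟨x, hK x (by simp)⟩⟩⟧, rfl⟩
  exact ⟨ι, inferInstance, hdir, hne, fun i => i.1, fun i => inferInstance, f, hsys,
    fun i => i.2, ⟨(MulEquiv.ofBijective φ hφ).symm⟩⟩

/-! ### Reading normal subgroups off the norm. -/

section Isomorphisms

variable {G S : Type u} [Group G] [SemilatticeSup S] [OrderBot S] {ν : G → S}

theorem IsNormalNorm.le_sup_of_mem_normalClosure (hν : IsNormalNorm ν) {Y : Set G} {a : S}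
    (hY : ∀ y ∈ Y, ν y ≤ a) {x : G} (hx : x ∈ Subgroup.normalClosure Y) : ν x ≤ a := by
  have := hν.idealSubgroup_normal (· ≤ a) bot_le fun _ _ _ h h1 h2 => h.trans (sup_le h1 h2)
  exact Subgroup.normalClosure_le_normal (N := hν.idealSubgroup (· ≤ a) bot_le
    fun _ _ _ h h1 h2 => h.trans (sup_le h1 h2)) hY hx

/-- The normal closure of one element of norm `a` is `{x | ν x ≤ a}`, and that of a finite set
equals that of any element whose norm is the join. -/
theorem IsNormalNorm.nonempty_orderIso (hν : IsNormalNorm ν) (hsurj : Function.Surjective ν)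
    (h : ∀ (x : G) (Y : Finset G), ν x ≤ Y.sup ν → x ∈ Subgroup.normalClosure (Y : Set G)) :
    Nonempty (S ≃o FGNormalSubgroup G) := by
  classical
  choose g hg using hsurj
  have hmem : ∀ a x, x ∈ Subgroup.normalClosure {g a} ↔ ν x ≤ a := by
    refine fun a x => ⟨hν.le_sup_of_mem_normalClosure (by simp [hg]), fun hx => ?_⟩
    simpa using h x {g a} (by simpa [hg] using hx)
  let F : S → FGNormalSubgroup G := fun a => ⟨_, {g a}, Set.finite_singleton _, rfl⟩
  have hF : ∀ a b, F a ≤ F b ↔ a ≤ b := by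
    intro a b
    constructor
    · intro hab
      have : g a ∈ Subgroup.normalClosure {g b} := hab ((hmem a (g a)).2 (hg a).le)
      rwa [hmem, hg] at this
    · intro hab x hx
      exact (hmem b x).2 (((hmem a x).1 hx).trans hab)
  refine ⟨RelIso.ofSurjective (OrderEmbedding.ofMapLEIff F hF) ?_⟩
  rintro ⟨N, Y, hY, rfl⟩
  refine ⟨hY.toFinset.sup ν, Subtype.ext (Subgroup.ext fun x => ?_)⟩
  refine (hmem _ x).trans ⟨fun hx => by simpa using h x _ hx, ?_⟩
  exact hν.le_sup_of_mem_normalClosure fun y hy => Finset.le_sup (by simpa using hy)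

end Isomorphisms

/-! ### Algebraic lattices and their compact elements. -/

section Algebraic

variable {L : Type u} [CompleteLattice L]

theorem IsCompactElement.sup {a b : L} (ha : IsCompactElement a) (hb : IsCompactElement b) :
    IsCompactElement (a ⊔ b) := by
  classical
  have := CompleteLattice.isCompactElement_finsetSup (f := id) ({a, b} : Finset L) (by
    intro x hx
    rcases Finset.mem_insert.1 hx with rfl | hx
    · exact ha
    · rw [Finset.mem_singleton.1 hx]
      exact hb)
  simpa using this

/-- The join-semilattice of compact elements. -/
instance compactElementsSemilatticeSup : SemilatticeSup {c : L // IsCompactElement c} :=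
  Subtype.semilatticeSup fun _ _ ha hb => ha.sup hb

/-- The least compact element. -/
instance compactElementsOrderBot : OrderBot {c : L // IsCompactElement c} :=
  Subtype.orderBot (by simpa using CompleteLattice.isCompactElement_finsetSup (f := id) (∅ : Finset L) (by simp))

theorem coe_compactElements_finsetSup {X : Type*} (Y : Finset X)
    (ν : X → {c : L // IsCompactElement c}) : ((Y.sup ν : {c : L // IsCompactElement c}) : L) =
      Y.sup fun y => (ν y : L) :=
  Finset.apply_sup_eq_sup_comp (g := Subtype.val) (fun _ _ => rfl) rfl

theorem IsCompactElement.exists_finset_le_sup {c : L} (hc : IsCompactElement c) {X : Type*}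
    (ν : X → L) (N : Set X) (h : c ≤ ⨆ x ∈ N, ν x) :
    ∃ Y : Finset X, (∀ y ∈ Y, y ∈ N) ∧ c ≤ Y.sup ν := by
  rw [iSup_subtype'] at h
  obtain ⟨T, hT⟩ := CompleteLattice.IsCompactElement.exists_finset_of_le_iSup L hc _ h
  refine ⟨T.map (Function.Embedding.subtype _), fun y hy => ?_, ?_⟩
  · obtain ⟨z, -, rfl⟩ := Finset.mem_map.1 hy
    exact z.2
  · rw [Finset.sup_map, Finset.sup_eq_iSup]
    exact hT

variable [IsCompactlyGenerated L]

theorem exists_compact_le_of_le_sup {a b c : L} (hc : IsCompactElement c) (h : c ≤ a ⊔ b) :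
    ∃ a' b', IsCompactElement a' ∧ IsCompactElement b' ∧ a' ≤ a ∧ b' ≤ b ∧ c ≤ a' ⊔ b' := by
  classical
  obtain ⟨Y, hY, hcY⟩ := hc.exists_finset_le_sup id
    {x | IsCompactElement x ∧ (x ≤ a ∨ x ≤ b)} (by
      refine h.trans (sup_le ?_ ?_)
      · rw [← sSup_compact_le_eq a]
        exact sSup_le fun x hx => le_iSup₂_of_le x ⟨hx.1, Or.inl (by simpa using hx.2)⟩ le_rfl
      · rw [← sSup_compact_le_eq b]
        exact sSup_le fun x hx => le_iSup₂_of_le x ⟨hx.1, Or.inr (by simpa using hx.2)⟩ le_rfl)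
  refine ⟨(Y.filter (· ≤ a)).sup id, (Y.filter (· ≤ b)).sup id,
    CompleteLattice.isCompactElement_finsetSup _ fun x hx => (hY x (Finset.mem_filter.1 hx).1).1,
    CompleteLattice.isCompactElement_finsetSup _ fun x hx => (hY x (Finset.mem_filter.1 hx).1).1,
    Finset.sup_le fun x hx => (Finset.mem_filter.1 hx).2,
    Finset.sup_le fun x hx => (Finset.mem_filter.1 hx).2, hcY.trans (Finset.sup_le fun x hx => ?_)⟩
  rcases (hY x hx).2 with hxa | hxb
  · exact le_sup_of_le_left (Finset.le_sup (f := id) (Finset.mem_filter.2 ⟨hx, hxa⟩))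
  · exact le_sup_of_le_right (Finset.le_sup (f := id) (Finset.mem_filter.2 ⟨hx, hxb⟩))

/-- Distributivity gives `c = (c ⊓ a) ⊔ (c ⊓ b)`. These meets need not be compact, but compactness
of `c` replaces them by compact elements below. -/
theorem isDistribSemilattice_compactElements
    (hL : ∀ x y z : L, x ⊓ (y ⊔ z) = (x ⊓ y) ⊔ (x ⊓ z)) :
    IsDistribSemilattice {c : L // IsCompactElement c} := by
  rintro ⟨a, ha⟩ ⟨b, hb⟩ ⟨c, hc⟩ h
  have h' : c ≤ a ⊔ b := h
  obtain ⟨a', b', ha', hb', h1, h2, h3⟩ := exists_compact_le_of_le_sup (a := c ⊓ a) (b := c ⊓ b) hc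
    (by rw [← hL]; exact le_inf le_rfl h')
  exact ⟨⟨a', ha'⟩, ⟨b', hb'⟩, h1.trans inf_le_right, h2.trans inf_le_right, Subtype.ext
    (le_antisymm h3 (sup_le (h1.trans inf_le_left) (h2.trans inf_le_left)))⟩

theorem IsNormalNorm.nonempty_orderIso_normalSubgroupLattice {G : Type u} [Group G]
    {ν : G → {c : L // IsCompactElement c}} (hν : IsNormalNorm ν) (hsurj : Function.Surjective ν)
    (h : ∀ (x : G) (Y : Finset G), ν x ≤ Y.sup ν → x ∈ Subgroup.normalClosure (Y : Set G)) :
    Nonempty (L ≃o NormalSubgroupLattice G) := by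
  let I : L → {c : L // IsCompactElement c} → Prop := fun a c => (c : L) ≤ a
  have hI0 : ∀ a, I a ⊥ := fun a => bot_le (a := a)
  have hI : ∀ a b c d, b ≤ c ⊔ d → I a c → I a d → I a b := fun a b c d hb hc hd =>
    le_trans (show (b : L) ≤ c ⊔ d from hb) (sup_le hc hd)
  let F : L → NormalSubgroupLattice G := fun a =>
    ⟨hν.idealSubgroup (I a) (hI0 a) (hI a), hν.idealSubgroup_normal _ _ _⟩
  have hF : ∀ a b, F a ≤ F b ↔ a ≤ b := by
    intro a b
    constructor
    · intro hab
      refine le_iff_compact_le_imp.2 fun c hc hca => ?_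
      obtain ⟨x, hx⟩ := hsurj ⟨c, hc⟩
      have hxa : ((ν x : {c : L // IsCompactElement c}) : L) ≤ a := by rw [hx]; exact hca
      have hxb : ((ν x : {c : L // IsCompactElement c}) : L) ≤ b := hab hxa
      rwa [hx] at hxb
    · intro hab x hx
      exact le_trans (show (ν x : L) ≤ a from hx) hab
  refine ⟨RelIso.ofSurjective (OrderEmbedding.ofMapLEIff F hF) ?_⟩
  rintro ⟨N, hN⟩
  -- The preimage of `N` is the join of its norms. Compactness of `ν x` reduces membership to a
  -- finite `Y ⊆ N`, where the normal closure property applies.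
  refine ⟨⨆ x ∈ (N : Set G), (ν x : L), Subtype.ext (Subgroup.ext fun x => ⟨fun hx => ?_,
    fun hx => le_iSup₂_of_le (f := fun x (_ : x ∈ (N : Set G)) => (ν x : L)) x hx le_rfl⟩)⟩
  obtain ⟨Y, hY, hxY⟩ := (ν x).2.exists_finset_le_sup (fun x => (ν x : L)) (N : Set G) hx
  refine Subgroup.normalClosure_le_normal (N := N) (fun y hy => hY y hy) (h x Y ?_)
  change (ν x : L) ≤ (Y.sup ν : {c : L // IsCompactElement c})
  rwa [coe_compactElements_finsetSup]

end Algebraic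

theorem theoremT :
    (∀ (S : Type u) [SemilatticeSup S] [OrderBot S],
      IsDistribSemilattice S → #S ≤ ℵ₁ →
        ∃ (G : Type u) (_ : Group G), IsDirectLimitOfFinProdAlternating G ∧
          Nonempty (S ≃o FGNormalSubgroup G)) ∧
    (∀ (L : Type u) [CompleteLattice L] [IsCompactlyGenerated L],
      (∀ x y z : L, x ⊓ (y ⊔ z) = (x ⊓ y) ⊔ (x ⊓ z)) →
      #{c : L // IsCompactElement c} ≤ ℵ₁ →
        ∃ (G : Type u) (_ : Group G), IsLocallyFiniteGroup G ∧
          Nonempty (L ≃o NormalSubgroupLattice G)) := by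
  constructor
  · intro S _ _ hS hcard
    obtain ⟨G, _, ν, hν, hG, hsurj, h⟩ := hS.exists_normed_group hcard
    exact ⟨G, inferInstance, hG.isDirectLimit, hν.nonempty_orderIso hsurj h⟩
  · intro L _ _ hL hcard
    obtain ⟨G, _, ν, hν, hG, hsurj, h⟩ :=
      (isDistribSemilattice_compactElements hL).exists_normed_group hcard
    exact ⟨G, inferInstance, hG.isLocallyFiniteGroup,
      hν.nonempty_orderIso_normalSubgroupLattice hsurj h⟩
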